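/- Consider the linearly restricted Gaussian VAR(1) model $$X_0=0,\qquad X_{t+1}=A(\theta)X_t+\eta_t\quad(0\le t\le n),\qquad \eta_t\ \text{i.i.d. } N(0,\sigma^2I_d),\ \sigma>0.$$ Here $\theta\in\mathbb R^m$ with $m\ge1$, $R\in\mathbb R^{d^2\times m}$ is a known matrix of rank $m$, $\gamma\in\mathbb R^{d^2}$ is a known vector, $\beta=\beta(\theta)=R\theta+\gamma$, and $A(\theta)\in\mathbb R^{d\times d}$ is the matrix with $\operatorname{vec}(A(\theta)^{\mathrm T})=\beta(\theta)$. Let $\mathrm{pr}^{(n)}_\theta$ be the law of the sample $(X_1,\dots,X_{n+1})$. For $\bar\rho>0$ put $\Theta(\bar\rho)=\{\theta\in\mathbb R^m:\rho(A(\theta))\le\bar\rho\}$, where $\rho(\cdot)$ is the spectral radius, and $\gamma_n(\bar\rho)=\sum_{s=0}^{n-1}\bar\rho^{2s}$. There is a universal constant $c>0$ such that the following holds for all $d$, $m$, $n$, $R$, $\gamma$, $\sigma$ as above, all $\bar\rho>0$, $\delta\in(0,1/4)$ and $\epsilon\in(0,\bar\rho/4]$. Suppose that $\gamma=0$, or,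 when $\gamma\ne0$, that there is a $\theta_0\in\mathbb R^m$ with $\lVert A(\theta_0)\rVert_2+4\epsilon\le\bar\rho$ (spectral norm). If $$n\,\gamma_n(\bar\rho)\le c\,\frac{m+\log(1/\delta)}{\epsilon^2},$$ then $$\inf_{\widehat\beta}\ \sup_{\theta\in\Theta(\bar\rho)}\mathrm{pr}^{(n)}_\theta\bigl\{\lVert\widehat\beta-\beta(\theta)\rVert\ge\epsilon\bigr\}\ \ge\ \delta,$$ where the infimum is over all estimators $\widehat\beta$, that is, measurable functions of $(X_1,\dots,X_{n+1})$ with values in $\mathbb R^{d^2}$, and $\lVert\cdot\rVert$ is the Euclidean norm. -/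

import Mathlib

open MeasureTheory ProbabilityTheory
open scoped Matrix

namespace RestrictedVAR

/-- The restricted coefficient vector `β = R θ + γ ∈ ℝ^{d²}`. The coordinates of `ℝ^{d²}` are
indexed by pairs `(i, j)`, in accordance with `β = vec(Aᵀ)`: the entry `(i, j)` of `β` is the
entry of `A` in row `i` and column `j`. The norm on this space is the Euclidean norm. -/
def coeff {d m : ℕ} (R : Matrix (Fin d × Fin d) (Fin m) ℝ) (γ : EuclideanSpace ℝ (Fin d × Fin d))
    (θ : Fin m → ℝ) : EuclideanSpace ℝ (Fin d × Fin d) :=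
  WithLp.toLp 2 (R *ᵥ θ) + γ

/-- The transition matrix `A(θ)`, whose `i`-th row is `(R_i θ + γ_i)ᵀ`, where `R_i` and `γ_i` are
the `i`-th blocks of `d` rows of `R` and `γ`. -/
def transition {d m : ℕ} (R : Matrix (Fin d × Fin d) (Fin m) ℝ)
    (γ : EuclideanSpace ℝ (Fin d × Fin d)) (θ : Fin m → ℝ) : Matrix (Fin d) (Fin d) ℝ :=
  Matrix.of fun i j => coeff R γ θ (i, j)

/-- The parameters `θ` for which the spectral radius of `A(θ)` (the largest modulus of a complex
eigenvalue) is at most `r`. -/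
def paramSet {d m : ℕ} (R : Matrix (Fin d × Fin d) (Fin m) ℝ)
    (γ : EuclideanSpace ℝ (Fin d × Fin d)) (r : ℝ) : Set (Fin m → ℝ) :=
  {θ | spectralRadius ℂ ((transition R γ θ).map Complex.ofReal) ≤ ENNReal.ofReal r}

/-- The vector autoregressive recursion `X_0 = 0`, `X_{t+1} = A X_t + η_t`. -/
def path {d : ℕ} (A : Matrix (Fin d) (Fin d) ℝ) (η : ℕ → Fin d → ℝ) : ℕ → Fin d → ℝ
  | 0 => 0
  | t + 1 => A *ᵥ path A η t + η t

/-- The sample `(X_1, …, X_{n+1})` as a function of the innovations `(η_0, …, η_n)`. The later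
innovations do not enter and are filled up with zeros. -/
def sample {d : ℕ} (A : Matrix (Fin d) (Fin d) ℝ) (n : ℕ) (η : Fin (n + 1) → Fin d → ℝ) :
    Fin (n + 1) → Fin d → ℝ :=
  fun t => path A (fun s => if h : s < n + 1 then η ⟨s, h⟩ else 0) (t + 1)

/-- The law of `n + 1` independent innovations with distribution `N(0, σ² I_d)`. -/
noncomputable def noiseLaw (d n : ℕ) (σ : ℝ) : Measure (Fin (n + 1) → Fin d → ℝ) :=
  Measure.pi fun _ => Measure.pi fun _ => gaussianReal 0 (σ ^ 2).toNNReal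

/-- The law of the sample `(X_1, …, X_{n+1})` when the transition matrix is `A`. -/
noncomputable def sampleLaw {d : ℕ} (A : Matrix (Fin d) (Fin d) ℝ) (n : ℕ) (σ : ℝ) :
    Measure (Fin (n + 1) → Fin d → ℝ) :=
  (noiseLaw d n σ).map (sample A n)

/-- The sample depends measurably on the innovations, so that `sampleLaw` is their honest
image measure. -/
theorem measurable_sample {d : ℕ} (A : Matrix (Fin d) (Fin d) ℝ) (n : ℕ) :
    Measurable (sample A n) := by
  have key : ∀ t : ℕ, Continuous fun η : Fin (n + 1) → Fin d → ℝ =>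
      path A (fun s => if h : s < n + 1 then η ⟨s, h⟩ else 0) t := by
    intro t
    induction t with
    | zero => exact continuous_const
    | succ t ih =>
      refine (Continuous.matrix_mulVec continuous_const ih).add ?_
      by_cases h : t < n + 1
      · simp only [h, dif_pos]
        exact continuous_apply _
      · simp only [h, dif_neg, not_false_iff]
        exact continuous_const
  exact measurable_pi_lambda _ fun t => (key (t + 1)).measurable

/-- An estimator of `β`: a measurable function of the sample `(X_1, …, X_{n+1})`. -/
abbrev Estimator (d n : ℕ) : Type :=
  {b : (Fin (n + 1) → Fin d → ℝ) → EuclideanSpace ℝ (Fin d × Fin d) // Measurable b}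

end RestrictedVAR

/-!
The lower bound comes from a change of measure between one parameter and exponentially many others.

In the `m`-dimensional affine space of coefficient vectors there are, by comparing volumes, `2^m`
points in a ball of radius `4ε` around `β(θ₀)`, one of them the centre, at mutual distances at least
`2ε` (`exists_separated_parameters`). All of them are admissible, since the spectral radius is at
most the spectral norm, which exceeds that of `A(θ₀)` by at most the Frobenius distance, `≤ 4ε`
(`norm_transition_le`, `spectralRadius_map_ofReal_le`). If an estimator errs with probability less
than `δ` at each of them, the `2^m - 1` disjoint events of being `ε`-close to a noncentral point have
probability more than `3/4` each under their own parameter, but less than `δ` together under `θ₀`.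

The map from the innovations to the sample is linear with determinant one, so the sample has the
Gaussian density evaluated at the residuals, and the log-likelihood ratio of `A` to `A₀` at the sample
is `(2⟨η, u⟩ + ‖u‖²) / (2σ²)` with `u_t = (A - A₀) X_t`. By the second-moment recursion
(`lintegral_path_succ`) `E‖u‖² ≤ σ² ‖A - A₀‖_F² n γ_n(ρ)`, which is at most a small multiple of
`σ² (m + log (1/δ))`. Hence the log-likelihood ratio is at most `a = log ((2^m - 1) / (2δ))`
with probability at least `3/4` (`sampleLaw_logLikelihood_tail`), and each of the events above has
probability at least `exp (-a) / 2` under `θ₀`. Summing gives at least `δ`, a contradiction. This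
choice of `a` treats the regimes `m ≫ log (1/δ)` and `m ≪ log (1/δ)` at once.
-/

namespace RestrictedVAR

/-! ### Density of the Gaussian noise -/

theorem pi_withDensity_ofReal {ι : Type*} [Fintype ι] {Ω : ι → Type*}
    [∀ i, MeasurableSpace (Ω i)] (μ : ∀ i, Measure (Ω i)) [∀ i, SigmaFinite (μ i)]
    (f : ∀ i, Ω i → ℝ) (hf0 : ∀ i x, 0 ≤ f i x) (hf : ∀ i, Integrable (f i) (μ i)) :
    Measure.pi (fun i => (μ i).withDensity fun x => ENNReal.ofReal (f i x)) =
      (Measure.pi μ).withDensity fun x => ENNReal.ofReal (∏ i, f i (x i)) := by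
  have hfin : ∀ i, IsFiniteMeasure ((μ i).withDensity fun x => ENNReal.ofReal (f i x)) :=
    fun i => isFiniteMeasure_withDensity_ofReal (hf i).2
  refine Measure.pi_eq (μ := fun i => (μ i).withDensity fun x => ENNReal.ofReal (f i x))
    fun s hs => ?_
  rw [withDensity_apply _ (MeasurableSet.univ_pi hs), Measure.restrict_pi_pi,
    ← ofReal_integral_eq_lintegral_ofReal, integral_fintype_prod_eq_prod,
    ENNReal.ofReal_prod_of_nonneg]
  · refine Finset.prod_congr rfl fun i _ => ?_
    rw [withDensity_apply _ (hs i), ofReal_integral_eq_lintegral_ofReal (hf i).restrict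
      (Filter.Eventually.of_forall (hf0 i))]
  · exact fun i _ => integral_nonneg (hf0 i)
  · exact Integrable.fintype_prod_dep fun i => (hf i).restrict
  · exact Filter.Eventually.of_forall fun x => Finset.prod_nonneg fun i _ => hf0 i _

/-- The squared Euclidean norm of an array of vectors. -/
def energy {d n : ℕ} (x : Fin (n + 1) → Fin d → ℝ) : ℝ := ∑ t, ∑ i, x t i ^ 2

/-- The noise has a density proportional to `exp (-energy / (2σ²))`. The normalizing constant `K`
cancels in every likelihood ratio, so its value is left unspecified. -/
theorem noiseLaw_eq_withDensity (d n : ℕ) {σ : ℝ} (hσ : 0 < σ) :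
    ∃ K : ℝ, 0 ≤ K ∧ noiseLaw d n σ = volume.withDensity fun η =>
      ENNReal.ofReal (K * Real.exp (-energy η / (2 * σ ^ 2))) := by
  have hv : (σ ^ 2).toNNReal ≠ 0 := by
    simpa using hσ.ne'
  have h1 : (gaussianReal 0 (σ ^ 2).toNNReal) =
      (volume : Measure ℝ).withDensity fun x =>
        ENNReal.ofReal (gaussianPDFReal 0 (σ ^ 2).toNNReal x) :=
    gaussianReal_of_var_ne_zero 0 hv
  have hnn := gaussianPDFReal_nonneg 0 (σ ^ 2).toNNReal
  have hint := integrable_gaussianPDFReal 0 (σ ^ 2).toNNReal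
  refine ⟨∏ _t : Fin (n + 1), ∏ _i : Fin d, (√(2 * Real.pi * (σ ^ 2).toNNReal))⁻¹,
    by positivity, ?_⟩
  unfold noiseLaw
  rw [h1, pi_withDensity_ofReal (fun _ : Fin d => (volume : Measure ℝ))
      (fun _ => gaussianPDFReal 0 (σ ^ 2).toNNReal) (fun _ => hnn) (fun _ => hint),
    pi_withDensity_ofReal (fun _ : Fin (n + 1) => Measure.pi fun _ : Fin d => (volume : Measure ℝ))
      (fun _ x => ∏ i, gaussianPDFReal 0 (σ ^ 2).toNNReal (x i))
      (fun _ x => Finset.prod_nonneg fun i _ => hnn _)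
      (fun _ => Integrable.fintype_prod_dep fun i => hint)]
  change volume.withDensity _ = _
  congr 1
  ext η
  congr 1
  simp only [gaussianPDFReal, Finset.prod_mul_distrib, ← Real.exp_sum, energy]
  congr 2
  rw [Real.coe_toNNReal _ (by positivity), ← Finset.sum_neg_distrib, Finset.sum_div]
  refine Finset.sum_congr rfl fun t _ => ?_
  rw [← Finset.sum_neg_distrib, Finset.sum_div]
  exact Finset.sum_congr rfl fun i _ => by simp

/-! ### Density of the sample -/

/-- The linear map sending `(x_1, …, x_{n+1})` to `(0, B x_1, …, B x_n)`. -/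
def shift {d : ℕ} (n : ℕ) (B : Matrix (Fin d) (Fin d) ℝ) :
    (Fin (n + 1) → Fin d → ℝ) →ₗ[ℝ] (Fin (n + 1) → Fin d → ℝ) where
  toFun x := Fin.cons 0 fun s : Fin n => B *ᵥ x s.castSucc
  map_add' x y := by
    ext t i
    refine Fin.cases ?_ (fun s => ?_) t <;> simp [Matrix.mulVec_add]
  map_smul' c x := by
    ext t i
    refine Fin.cases ?_ (fun s => ?_) t <;> simp [Matrix.mulVec_smul]

theorem shift_apply_zero {d n : ℕ} (B : Matrix (Fin d) (Fin d) ℝ) (x : Fin (n + 1) → Fin d → ℝ) :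
    shift n B x 0 = 0 := rfl

theorem shift_apply_succ {d n : ℕ} (B : Matrix (Fin d) (Fin d) ℝ) (x : Fin (n + 1) → Fin d → ℝ)
    (s : Fin n) : shift n B x s.succ = B *ᵥ x s.castSucc := rfl

theorem isNilpotent_shift {d n : ℕ} (B : Matrix (Fin d) (Fin d) ℝ) : IsNilpotent (shift n B) := by
  have key : ∀ (k : ℕ) (x : Fin (n + 1) → Fin d → ℝ) (t : Fin (n + 1)), (t : ℕ) < k →
      ((shift n B) ^ k) x t = 0 := by
    intro k
    induction k with
    | zero => intro x t h; omega
    | succ k ih =>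
      intro x t
      rw [pow_succ', Module.End.mul_apply]
      refine Fin.cases (fun _ => shift_apply_zero _ _) (fun s hs => ?_) t
      rw [shift_apply_succ, ih, Matrix.mulVec_zero]
      simpa using hs
  exact ⟨n + 1, LinearMap.ext fun x => funext fun t => key _ x t t.2⟩

/-- The map recovering the innovations from the sample: `x_{t+1} ↦ x_{t+1} - B x_t`. -/
def resid {d : ℕ} (n : ℕ) (B : Matrix (Fin d) (Fin d) ℝ) :
    (Fin (n + 1) → Fin d → ℝ) →ₗ[ℝ] (Fin (n + 1) → Fin d → ℝ) :=
  1 - shift n B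

theorem resid_apply {d n : ℕ} (B : Matrix (Fin d) (Fin d) ℝ) (x : Fin (n + 1) → Fin d → ℝ) :
    resid n B x = x - shift n B x := rfl

/-- `resid` is unipotent, since `shift` is nilpotent. -/
theorem det_resid {d n : ℕ} (B : Matrix (Fin d) (Fin d) ℝ) : LinearMap.det (resid n B) = 1 := by
  have h := (isNilpotent_shift (n := n) B).charpoly_eq_X_pow_finrank
  have h2 := LinearMap.eval_charpoly (shift n B) 1
  rw [h] at h2
  simpa [resid] using h2.symm

theorem measurePreserving_resid {d n : ℕ} (B : Matrix (Fin d) (Fin d) ℝ) :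
    MeasurePreserving (resid n B) := by
  refine ⟨(LinearMap.continuous_of_finiteDimensional _).measurable, ?_⟩
  have : Measure.IsAddHaarMeasure (volume : Measure (Fin (n + 1) → Fin d → ℝ)) :=
    Measure.pi.isAddHaarMeasure fun _ : Fin (n + 1) => (volume : Measure (Fin d → ℝ))
  rw [Measure.map_linearMap_addHaar_eq_smul_addHaar _ (by rw [det_resid]; exact one_ne_zero),
    det_resid]
  simp

/-- The innovations, continued by zeros, as they enter the definition of `sample`. -/
def extend {d n : ℕ} (η : Fin (n + 1) → Fin d → ℝ) : ℕ → Fin d → ℝ :=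
  fun s => if h : s < n + 1 then η ⟨s, h⟩ else 0

theorem extend_val {d n : ℕ} (η : Fin (n + 1) → Fin d → ℝ) (t : Fin (n + 1)) :
    extend η t = η t := by
  simp only [extend, t.2, dif_pos, Fin.eta]

theorem shift_sample {d n : ℕ} (A B : Matrix (Fin d) (Fin d) ℝ) (η : Fin (n + 1) → Fin d → ℝ)
    (t : Fin (n + 1)) : shift n B (sample A n η) t = B *ᵥ path A (extend η) t := by
  refine Fin.cases ?_ (fun s => ?_) t
  · simp [shift_apply_zero, path]
  · rw [shift_apply_succ]
    rfl

theorem resid_sample {d n : ℕ} (A : Matrix (Fin d) (Fin d) ℝ) (η : Fin (n + 1) → Fin d → ℝ) :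
    resid n A (sample A n η) = η := by
  ext1 t
  have h : sample A n η t = A *ᵥ path A (extend η) t + extend η t := rfl
  rw [resid_apply, Pi.sub_apply, shift_sample, h, add_sub_cancel_left, extend_val]

theorem sample_resid {d n : ℕ} (A : Matrix (Fin d) (Fin d) ℝ) (x : Fin (n + 1) → Fin d → ℝ) :
    sample A n (resid n A x) = x := by
  have hinj : Function.Injective (resid n A) :=
    ((resid n A).equivOfDetNeZero (by rw [det_resid]; exact one_ne_zero)).injective
  exact hinj (resid_sample A _)

/-- Since `resid` is the inverse of `sample` and preserves Lebesgue measure, the density of the sample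
is the density of the noise evaluated at the residuals. -/
theorem sampleLaw_apply {d n : ℕ} (A : Matrix (Fin d) (Fin d) ℝ) {σ K : ℝ}
    (hK : noiseLaw d n σ = volume.withDensity fun η =>
      ENNReal.ofReal (K * Real.exp (-energy η / (2 * σ ^ 2))))
    {B : Set (Fin (n + 1) → Fin d → ℝ)} (hB : MeasurableSet B) :
    sampleLaw A n σ B =
      ∫⁻ x in B, ENNReal.ofReal (K * Real.exp (-energy (resid n A x) / (2 * σ ^ 2))) := by
  have hm := measurable_sample A n
  have hmeas : Measurable fun η : Fin (n + 1) → Fin d → ℝ =>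
      ENNReal.ofReal (K * Real.exp (-energy η / (2 * σ ^ 2))) := by
    unfold energy; fun_prop
  rw [sampleLaw, Measure.map_apply hm hB, hK, withDensity_apply _ (hm hB),
    ← (measurePreserving_resid A).setLIntegral_comp_preimage (hm hB) hmeas]
  congr 2
  ext x
  simp [sample_resid]

instance isProbabilityMeasure_noiseLaw (d n : ℕ) (σ : ℝ) :
    IsProbabilityMeasure (noiseLaw d n σ) := by
  unfold noiseLaw; infer_instance

instance isProbabilityMeasure_sampleLaw {d n : ℕ} (A : Matrix (Fin d) (Fin d) ℝ) (σ : ℝ) :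
    IsProbabilityMeasure (sampleLaw A n σ) :=
  Measure.isProbabilityMeasure_map (measurable_sample A n).aemeasurable

theorem measurable_energy_resid {d n : ℕ} (A : Matrix (Fin d) (Fin d) ℝ) :
    Measurable fun x : Fin (n + 1) → Fin d → ℝ => energy (resid n A x) := by
  have h : Measurable (resid n A) := (measurePreserving_resid A).measurable
  have h2 : Measurable (energy : (Fin (n + 1) → Fin d → ℝ) → ℝ) := by unfold energy; fun_prop
  exact h2.comp h

/-- Change of measure: on an event where the log-likelihood ratio of `A` to `A'` is at most `a`, the
probability under `A` is at most `exp a` times the one under `A'`. -/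
theorem sampleLaw_le_exp_mul {d n : ℕ} (A A' : Matrix (Fin d) (Fin d) ℝ) {σ : ℝ} (hσ : 0 < σ)
    (a : ℝ) {B : Set (Fin (n + 1) → Fin d → ℝ)} (hB : MeasurableSet B)
    (h : ∀ x ∈ B, energy (resid n A' x) - energy (resid n A x) ≤ 2 * σ ^ 2 * a) :
    sampleLaw A n σ B ≤ ENNReal.ofReal (Real.exp a) * sampleLaw A' n σ B := by
  obtain ⟨K, hK0, hK⟩ := noiseLaw_eq_withDensity d n hσ
  have hm := measurable_energy_resid (n := n) A'
  rw [sampleLaw_apply A hK hB, sampleLaw_apply A' hK hB, ← lintegral_const_mul _ (by fun_prop)]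
  refine setLIntegral_mono (by fun_prop) fun x hx => ?_
  rw [← ENNReal.ofReal_mul (Real.exp_pos a).le, mul_left_comm, ← Real.exp_add]
  refine ENNReal.ofReal_le_ofReal (mul_le_mul_of_nonneg_left (Real.exp_le_exp.2 ?_) hK0)
  have := h x hx
  rw [← sub_le_iff_le_add, ← sub_div, div_le_iff₀ (by positivity)]
  linarith

/-! ### Second moments of the path -/

theorem path_congr {d : ℕ} (A : Matrix (Fin d) (Fin d) ℝ) {η ξ : ℕ → Fin d → ℝ} {t : ℕ}
    (h : ∀ s < t, η s = ξ s) : path A η t = path A ξ t := by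
  induction t with
  | zero => rfl
  | succ t ih =>
    simp only [path]
    rw [ih fun s hs => h s (by omega), h t (by omega)]

theorem continuous_path_extend {d n : ℕ} (A : Matrix (Fin d) (Fin d) ℝ) (t : ℕ) :
    Continuous fun η : Fin (n + 1) → Fin d → ℝ => path A (extend η) t := by
  induction t with
  | zero => exact continuous_const
  | succ t ih =>
    refine (Continuous.matrix_mulVec continuous_const ih).add ?_
    unfold extend
    by_cases h : t < n + 1
    · simp only [h, dif_pos]
      exact continuous_apply _
    · simp only [h, dif_neg, not_false_iff]
      exact continuous_const

/-- The squared Frobenius norm. -/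
def frobSq {d : ℕ} (B : Matrix (Fin d) (Fin d) ℝ) : ℝ := ∑ i, ∑ j, B i j ^ 2

theorem frobSq_nonneg {d : ℕ} (B : Matrix (Fin d) (Fin d) ℝ) : 0 ≤ frobSq B := by
  unfold frobSq; positivity

theorem lintegral_sq_sum_gaussian {d : ℕ} (σ : ℝ) (b : Fin d → ℝ) :
    ∫⁻ z : Fin d → ℝ, ENNReal.ofReal ((∑ j, b j * z j) ^ 2)
      ∂(Measure.pi fun _ => gaussianReal 0 (σ ^ 2).toNNReal) =
      ENNReal.ofReal (σ ^ 2 * ∑ j, b j ^ 2) := by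
  have hL : ∀ j, MemLp (fun x : ℝ => b j * x) 2 (gaussianReal 0 (σ ^ 2).toNNReal) :=
    fun j => (memLp_id_gaussianReal 2).const_mul (b j)
  have hL2 : ∀ j, MemLp (fun z : Fin d → ℝ => b j * z j) 2
      (Measure.pi fun _ => gaussianReal 0 (σ ^ 2).toNNReal) := fun j =>
    (hL j).comp_measurePreserving
      (measurePreserving_eval (fun _ : Fin d => gaussianReal 0 (σ ^ 2).toNNReal) j)
  have hsum : MemLp (∑ j, fun z : Fin d → ℝ => b j * z j) 2
      (Measure.pi fun _ => gaussianReal 0 (σ ^ 2).toNNReal) := memLp_finsetSum' _ fun j _ => hL2 j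
  have hmean : ∀ j, ∫ z : Fin d → ℝ, b j * z j
      ∂(Measure.pi fun _ => gaussianReal 0 (σ ^ 2).toNNReal) = 0 := fun j => by
    have := integral_comp_eval (μ := fun _ : Fin d => gaussianReal 0 (σ ^ 2).toNNReal) (i := j)
      (f := fun x : ℝ => b j * x) (by fun_prop)
    rw [this, integral_const_mul]
    simp
  have hmean' : ∫ z : Fin d → ℝ, (∑ j, fun z : Fin d → ℝ => b j * z j) z
      ∂(Measure.pi fun _ => gaussianReal 0 (σ ^ 2).toNNReal) = 0 := by
    simp only [Finset.sum_apply]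
    rw [integral_finsetSum _ fun j _ => (hL2 j).integrable (by norm_num)]
    exact Finset.sum_eq_zero fun j _ => hmean j
  have hvar := variance_sum_pi (μ := fun _ : Fin d => gaussianReal 0 (σ ^ 2).toNNReal) hL
  rw [variance_of_integral_eq_zero hsum.aestronglyMeasurable.aemeasurable hmean'] at hvar
  have h1 := hsum.integrable_sq
  simp only [Finset.sum_apply] at hvar h1
  rw [← ofReal_integral_eq_lintegral_ofReal h1 (Filter.Eventually.of_forall fun _ => sq_nonneg _),
    hvar, Finset.mul_sum]
  congr 1
  refine Finset.sum_congr rfl fun j _ => ?_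
  rw [variance_const_mul, variance_fun_id_gaussianReal, Real.coe_toNNReal _ (sq_nonneg σ), mul_comm]

theorem lintegral_innovation {d n : ℕ} (σ : ℝ) (B : Matrix (Fin d) (Fin d) ℝ) (t : Fin (n + 1)) :
    ∫⁻ η, ENNReal.ofReal ((B *ᵥ η t) ⬝ᵥ (B *ᵥ η t)) ∂(noiseLaw d n σ) =
      ENNReal.ofReal (σ ^ 2 * frobSq B) := by
  have hev := measurePreserving_eval
    (fun _ : Fin (n + 1) => Measure.pi fun _ : Fin d => gaussianReal 0 (σ ^ 2).toNNReal) t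
  have hm : ∀ i, Measurable fun z : Fin d → ℝ => ENNReal.ofReal ((∑ j, B i j * z j) ^ 2) :=
    fun i => by fun_prop
  have h1 : ∀ η : Fin (n + 1) → Fin d → ℝ, ENNReal.ofReal ((B *ᵥ η t) ⬝ᵥ (B *ᵥ η t)) =
      ∑ i, ENNReal.ofReal ((∑ j, B i j * η t j) ^ 2) := fun η => by
    rw [← ENNReal.ofReal_sum_of_nonneg fun i _ => sq_nonneg _]
    simp [dotProduct, Matrix.mulVec, sq]
  have hm' : ∀ i, Measurable fun η : Fin (n + 1) → Fin d → ℝ =>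
      ENNReal.ofReal ((∑ j, B i j * η t j) ^ 2) := fun i => (hm i).comp (measurable_pi_apply t)
  simp_rw [h1]
  rw [lintegral_finsetSum _ fun i _ => hm' i, frobSq, Finset.mul_sum,
    ENNReal.ofReal_sum_of_nonneg fun i _ => by positivity]
  refine Finset.sum_congr rfl fun i _ => ?_
  rw [← lintegral_sq_sum_gaussian]
  exact hev.lintegral_comp (hm i)

/-- Changing the sign of the innovation at time `t`. -/
def flipSign {d n : ℕ} (t : Fin (n + 1)) (η : Fin (n + 1) → Fin d → ℝ) : Fin (n + 1) → Fin d → ℝ :=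
  fun s => if s = t then -η s else η s

theorem measurePreserving_flipSign {d n : ℕ} (σ : ℝ) (t : Fin (n + 1)) :
    MeasurePreserving (flipSign t) (noiseLaw d n σ) (noiseLaw d n σ) := by
  have h1 : MeasurePreserving (fun x : ℝ => -x) (gaussianReal 0 (σ ^ 2).toNNReal)
      (gaussianReal 0 (σ ^ 2).toNNReal) := ⟨measurable_neg, by simp [gaussianReal_map_neg]⟩
  have h2 : MeasurePreserving (fun x : Fin d → ℝ => -x)
      (Measure.pi fun _ => gaussianReal 0 (σ ^ 2).toNNReal)
      (Measure.pi fun _ => gaussianReal 0 (σ ^ 2).toNNReal) :=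
    measurePreserving_pi _ _ fun _ => h1
  refine measurePreserving_pi (f := fun s (x : Fin d → ℝ) => if s = t then -x else x) _ _
    fun s => ?_
  by_cases hs : s = t
  · simpa [hs] using h2
  · simp only [hs, if_false]
    exact MeasurePreserving.id _

/-- One step of the second-moment recursion. The cross term between `B A X_t` and `B η_t` is removed by
averaging over the sign of `η_t`, on which `X_t` does not depend; working with `∫⁻` throughout, no
integrability has to be checked. -/
theorem lintegral_path_succ {d n : ℕ} (σ : ℝ) (A B : Matrix (Fin d) (Fin d) ℝ) (t : Fin (n + 1)) :
    ∫⁻ η, ENNReal.ofReal ((B *ᵥ path A (extend η) (t + 1)) ⬝ᵥ (B *ᵥ path A (extend η) (t + 1)))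
        ∂(noiseLaw d n σ) =
      ∫⁻ η, ENNReal.ofReal (((B * A) *ᵥ path A (extend η) t) ⬝ᵥ ((B * A) *ᵥ path A (extend η) t))
        ∂(noiseLaw d n σ) + ENNReal.ofReal (σ ^ 2 * frobSq B) := by
  set F : (Fin (n + 1) → Fin d → ℝ) → ℝ := fun η =>
    (B *ᵥ path A (extend η) (t + 1)) ⬝ᵥ (B *ᵥ path A (extend η) (t + 1)) with hF
  set U : (Fin (n + 1) → Fin d → ℝ) → Fin d → ℝ := fun η => (B * A) *ᵥ path A (extend η) t with hU
  have hUc : Continuous U := continuous_const.matrix_mulVec (continuous_path_extend A t)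
  have hFc : Continuous F := by
    have := Continuous.matrix_mulVec (A := fun _ => B) continuous_const
      (continuous_path_extend (n := n) A (t + 1))
    exact this.dotProduct this
  have hUm : Measurable fun η => ENNReal.ofReal (U η ⬝ᵥ U η) :=
    (hUc.dotProduct hUc).measurable.ennreal_ofReal
  have e1 : ∀ η, F η = (U η + B *ᵥ η t) ⬝ᵥ (U η + B *ᵥ η t) := fun η => by
    have : path A (extend η) (t + 1) = A *ᵥ path A (extend η) t + η t := by
      rw [← extend_val η t]
      rfl
    simp only [hF, hU, this, Matrix.mulVec_add, Matrix.mulVec_mulVec]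
  have e2 : ∀ η, F (flipSign t η) = (U η - B *ᵥ η t) ⬝ᵥ (U η - B *ᵥ η t) := fun η => by
    have h1 : U (flipSign t η) = U η := by
      simp only [hU]
      rw [path_congr A fun s hs => ?_]
      have hs' : s < n + 1 := by omega
      have : (⟨s, hs'⟩ : Fin (n + 1)) ≠ t := fun h => by
        rw [← h] at hs
        simp at hs
      simp [extend, flipSign, hs', this]
    rw [e1, h1]
    simp [flipSign, Matrix.mulVec_neg, sub_eq_add_neg]
  -- the parallelogram law
  have key : ∀ η, ENNReal.ofReal (F η) + ENNReal.ofReal (F (flipSign t η)) =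
      2 * (ENNReal.ofReal (U η ⬝ᵥ U η) + ENNReal.ofReal ((B *ᵥ η t) ⬝ᵥ (B *ᵥ η t))) := fun η => by
    have hnn : ∀ v : Fin d → ℝ, 0 ≤ v ⬝ᵥ v := fun v => by
      simpa using dotProduct_star_self_nonneg v
    rw [e1, e2, ← ENNReal.ofReal_add (hnn _) (hnn _), ← ENNReal.ofReal_add (hnn _) (hnn _),
      ← ENNReal.ofReal_ofNat 2, ← ENNReal.ofReal_mul zero_le_two]
    congr 1
    simp only [add_dotProduct, dotProduct_add, sub_dotProduct, dotProduct_sub]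
    ring
  have hflip : ∫⁻ η, ENNReal.ofReal (F (flipSign t η)) ∂(noiseLaw d n σ) =
      ∫⁻ η, ENNReal.ofReal (F η) ∂(noiseLaw d n σ) :=
    (measurePreserving_flipSign σ t).lintegral_comp hFc.measurable.ennreal_ofReal
  have h2 : 2 * ∫⁻ η, ENNReal.ofReal (F η) ∂(noiseLaw d n σ) =
      2 * (∫⁻ η, ENNReal.ofReal (U η ⬝ᵥ U η) ∂(noiseLaw d n σ) +
        ENNReal.ofReal (σ ^ 2 * frobSq B)) := by
    rw [← lintegral_innovation σ B t, ← lintegral_add_left hUm,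
      ← lintegral_const_mul' 2 (fun η => ENNReal.ofReal (U η ⬝ᵥ U η) + _) (by simp),
      ← lintegral_congr key, lintegral_add_left hFc.measurable.ennreal_ofReal, hflip, two_mul]
  exact (ENNReal.mul_right_inj (by simp) (by simp)).1 h2

/-- `E ‖B X_t‖² ≤ σ² ‖B‖_F² ∑_{s < t} r^{2s}` when right multiplication by `A` increases Frobenius
norms by at most the factor `r`. -/
theorem lintegral_path_le {d n : ℕ} (σ : ℝ) {r : ℝ} (A : Matrix (Fin d) (Fin d) ℝ)
    (hA : ∀ B : Matrix (Fin d) (Fin d) ℝ, frobSq (B * A) ≤ r ^ 2 * frobSq B) (t : ℕ)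
    (ht : t ≤ n + 1) (B : Matrix (Fin d) (Fin d) ℝ) :
    ∫⁻ η : Fin (n + 1) → Fin d → ℝ,
      ENNReal.ofReal ((B *ᵥ path A (extend η) t) ⬝ᵥ (B *ᵥ path A (extend η) t))
        ∂(noiseLaw d n σ) ≤
      ENNReal.ofReal (σ ^ 2 * frobSq B * ∑ s ∈ Finset.range t, r ^ (2 * s)) := by
  induction t generalizing B with
  | zero => simp [path]
  | succ t ih =>
    have h0 : 0 ≤ ∑ s ∈ Finset.range t, r ^ (2 * s) :=
      Finset.sum_nonneg fun s _ => (even_two_mul s).pow_nonneg r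
    refine (lintegral_path_succ σ A B ⟨t, by omega⟩).trans_le ?_
    refine (add_le_add_left (ih (by omega) (B * A)) _).trans ?_
    have h1 := frobSq_nonneg (B * A)
    have h2 := frobSq_nonneg B
    rw [← ENNReal.ofReal_add (by positivity) (by positivity)]
    refine ENNReal.ofReal_le_ofReal ?_
    rw [Finset.sum_range_succ']
    simp only [mul_add, pow_add, mul_zero, pow_zero, mul_one]
    rw [← Finset.sum_mul]
    have := mul_le_mul_of_nonneg_left (hA B) (mul_nonneg (sq_nonneg σ) h0)
    linarith

theorem lintegral_energy_shift_le {d n : ℕ} (σ : ℝ) {r : ℝ} (A B : Matrix (Fin d) (Fin d) ℝ)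
    (hA : ∀ B : Matrix (Fin d) (Fin d) ℝ, frobSq (B * A) ≤ r ^ 2 * frobSq B) :
    ∫⁻ x, ENNReal.ofReal (energy (shift n B x)) ∂(sampleLaw A n σ) ≤
      ENNReal.ofReal (σ ^ 2 * frobSq B * (n * ∑ s ∈ Finset.range n, r ^ (2 * s))) := by
  have hE : Continuous fun x : Fin (n + 1) → Fin d → ℝ => energy (shift n B x) := by
    have := LinearMap.continuous_of_finiteDimensional (shift n B)
    unfold energy
    fun_prop
  have hnn : ∀ v : Fin d → ℝ, 0 ≤ v ⬝ᵥ v := fun v => by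
    simpa using dotProduct_star_self_nonneg v
  have hr : ∀ k, 0 ≤ ∑ s ∈ Finset.range k, r ^ (2 * s) := fun k =>
    Finset.sum_nonneg fun s _ => (even_two_mul s).pow_nonneg r
  have hB := frobSq_nonneg B
  rw [sampleLaw, lintegral_map hE.measurable.ennreal_ofReal (measurable_sample A n)]
  have h1 : ∀ η : Fin (n + 1) → Fin d → ℝ, ENNReal.ofReal (energy (shift n B (sample A n η))) =
      ∑ s : Fin n, ENNReal.ofReal ((B *ᵥ path A (extend η) (s + 1)) ⬝ᵥ
        (B *ᵥ path A (extend η) (s + 1))) := fun η => by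
    rw [← ENNReal.ofReal_sum_of_nonneg fun _ _ => hnn _, energy, Fin.sum_univ_succ]
    simp only [shift_sample]
    simp [path, dotProduct, sq]
  simp_rw [h1]
  have hm : ∀ s : Fin n, Continuous fun η : Fin (n + 1) → Fin d → ℝ =>
      (B *ᵥ path A (extend η) (s + 1)) := fun s =>
    continuous_const.matrix_mulVec (continuous_path_extend A _)
  rw [lintegral_finsetSum _ fun s _ => ((hm s).dotProduct (hm s)).measurable.ennreal_ofReal]
  calc _ ≤ ∑ _s : Fin n, ENNReal.ofReal (σ ^ 2 * frobSq B * ∑ s ∈ Finset.range n, r ^ (2 * s)) := by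
        refine Finset.sum_le_sum fun s _ => (lintegral_path_le σ A hA _ (by omega) B).trans ?_
        refine ENNReal.ofReal_le_ofReal (mul_le_mul_of_nonneg_left ?_ (by positivity))
        exact Finset.sum_le_sum_of_subset_of_nonneg (Finset.range_mono (by omega))
          fun k _ _ => (even_two_mul k).pow_nonneg r
    _ = _ := by
        have := hr n
        rw [← ENNReal.ofReal_sum_of_nonneg fun _ _ => by positivity]
        simp only [Finset.sum_const, Finset.card_univ, Fintype.card_fin, nsmul_eq_mul]
        congr 1
        ring

/-! ### Packing in a Euclidean ball -/

/-- Volume packing: a maximal `2ε`-separated subset of a ball of radius `4ε` in dimension `m` has at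
least `2^m` points, because the balls of radius `2ε` around its points cover the large ball. The
set is built up one point at a time, starting with the centre. -/
theorem exists_finset_separated {E : Type*} [NormedAddCommGroup E] [NormedSpace ℝ E]
    [FiniteDimensional ℝ E] {m : ℕ} (hm : Module.finrank ℝ E = m) {ε : ℝ} (hε : 0 < ε)
    (k : ℕ) (hk : k + 1 ≤ 2 ^ m) :
    ∃ S : Finset E, S.card = k + 1 ∧ 0 ∈ S ∧ (∀ x ∈ S, ‖x‖ ≤ 4 * ε) ∧
      ∀ x ∈ S, ∀ y ∈ S, x ≠ y → 2 * ε ≤ ‖x - y‖ := by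
  classical
  induction k with
  | zero => exact ⟨{0}, by simp, by simp, by simp [hε.le], by simp⟩
  | succ k ih =>
    obtain ⟨S, hcard, h0, hS, hsep⟩ := ih (by omega)
    obtain ⟨x, hx, hxS⟩ : ∃ x : E, ‖x‖ ≤ 4 * ε ∧ ∀ y ∈ S, 2 * ε ≤ ‖x - y‖ := by
      by_contra! hcon
      let _ : MeasurableSpace E := borel E
      have : BorelSpace E := ⟨rfl⟩
      let μ : Measure E := Measure.addHaar
      have hcov : Metric.closedBall (0 : E) (4 * ε) ⊆ ⋃ y ∈ S, Metric.ball y (2 * ε) := by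
        intro x hx
        obtain ⟨y, hy, hxy⟩ := hcon x (by simpa using hx)
        exact Set.mem_biUnion hy (by simpa [dist_eq_norm] using hxy)
      have h1 : μ (Metric.closedBall (0 : E) (4 * ε)) ≤ ∑ y ∈ S, μ (Metric.ball y (2 * ε)) :=
        (measure_mono hcov).trans (measure_biUnion_finset_le _ _)
      have hpos : μ (Metric.ball (0 : E) 1) ≠ 0 := (Metric.measure_ball_pos μ 0 one_pos).ne'
      have hfin : μ (Metric.ball (0 : E) 1) ≠ ⊤ := measure_ball_lt_top.ne
      simp only [Measure.addHaar_closedBall μ (0 : E) (by positivity : 0 ≤ 4 * ε),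
        Measure.addHaar_ball_of_pos μ _ (by positivity : 0 < 2 * ε), Finset.sum_const, nsmul_eq_mul,
        ← mul_assoc, hm, hcard] at h1
      rw [ENNReal.mul_le_mul_iff_left hpos hfin, ← ENNReal.ofReal_natCast,
        ← ENNReal.ofReal_mul (by positivity), ENNReal.ofReal_le_ofReal_iff (by positivity),
        show 4 * ε = 2 * (2 * ε) by ring, mul_pow 2 (2 * ε),
        mul_le_mul_iff_left₀ (by positivity)] at h1
      have : 2 ^ m ≤ k + 1 := by exact_mod_cast h1
      omega
    have hxn : x ∉ S := fun h => by
      have := hxS x h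
      rw [sub_self, norm_zero] at this
      linarith
    refine ⟨insert x S, by rw [Finset.card_insert_of_notMem hxn, hcard],
      Finset.mem_insert_of_mem h0, ?_, ?_⟩
    · intro y hy
      rcases Finset.mem_insert.1 hy with rfl | hy
      exacts [hx, hS y hy]
    · intro y hy z hz hyz
      rcases Finset.mem_insert.1 hy with hy' | hy' <;> rcases Finset.mem_insert.1 hz with hz' | hz'
      · exact absurd (hy'.trans hz'.symm) hyz
      · exact hy' ▸ hxS z hz'
      · rw [norm_sub_rev]
        exact hz' ▸ hxS y hy'
      · exact hsep y hy' z hz' hyz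

/-! ### Operator norm, Frobenius norm and spectral radius -/

theorem norm_toEuclideanCLM_le {d : ℕ} (B : Matrix (Fin d) (Fin d) ℝ) :
    ‖Matrix.toEuclideanCLM (𝕜 := ℝ) B‖ ≤ √(frobSq B) := by
  refine ContinuousLinearMap.opNorm_le_bound _ (Real.sqrt_nonneg _) fun x => ?_
  rw [EuclideanSpace.norm_eq, EuclideanSpace.norm_eq, ← Real.sqrt_mul (frobSq_nonneg B)]
  refine Real.sqrt_le_sqrt ?_
  simp only [Real.norm_eq_abs, sq_abs, frobSq]
  rw [Finset.sum_mul]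
  refine Finset.sum_le_sum fun i _ => ?_
  rw [Matrix.ofLp_toEuclideanCLM]
  exact Finset.sum_mul_sq_le_sq_mul_sq Finset.univ (fun j => B i j) fun j => x j

theorem frobSq_mul_le {d : ℕ} (A B : Matrix (Fin d) (Fin d) ℝ) :
    frobSq (B * A) ≤ ‖Matrix.toEuclideanCLM (𝕜 := ℝ) A‖ ^ 2 * frobSq B := by
  have hT : ‖Matrix.toEuclideanCLM (𝕜 := ℝ) Aᵀ‖ = ‖Matrix.toEuclideanCLM (𝕜 := ℝ) A‖ := by
    rw [← norm_star (Matrix.toEuclideanCLM (𝕜 := ℝ) A), ← map_star]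
    rfl
  unfold frobSq
  rw [Finset.mul_sum]
  refine Finset.sum_le_sum fun i _ => ?_
  have h := (Matrix.toEuclideanCLM (𝕜 := ℝ) Aᵀ).le_opNorm (WithLp.toLp 2 (B i))
  have h2 := pow_le_pow_left₀ (norm_nonneg _) h 2
  rw [mul_pow, EuclideanSpace.norm_sq_eq, EuclideanSpace.norm_sq_eq, hT] at h2
  simp only [Real.norm_eq_abs, sq_abs, Matrix.ofLp_toEuclideanCLM] at h2
  refine le_of_eq_of_le (Finset.sum_congr rfl fun j _ => ?_) h2
  rw [Matrix.mulVec_transpose]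
  rfl

/-- A complex eigenvector is split into its real and imaginary parts, to which the bound on the real
operator norm applies. -/
theorem spectralRadius_map_ofReal_le {d : ℕ} (A : Matrix (Fin d) (Fin d) ℝ) {r : ℝ}
    (hA : ‖Matrix.toEuclideanCLM (𝕜 := ℝ) A‖ ≤ r) :
    spectralRadius ℂ (A.map Complex.ofReal) ≤ ENNReal.ofReal r := by
  have hr : 0 ≤ r := (norm_nonneg _).trans hA
  have hreal : ∀ x : Fin d → ℝ, ∑ i, (A *ᵥ x) i ^ 2 ≤ r ^ 2 * ∑ i, x i ^ 2 := fun x => by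
    have h := (Matrix.toEuclideanCLM (𝕜 := ℝ) A).le_of_opNorm_le hA (WithLp.toLp 2 x)
    have h2 := pow_le_pow_left₀ (norm_nonneg _) h 2
    rw [mul_pow, EuclideanSpace.norm_sq_eq, EuclideanSpace.norm_sq_eq] at h2
    simpa only [Real.norm_eq_abs, sq_abs, Matrix.ofLp_toEuclideanCLM] using h2
  refine iSup₂_le fun k hk => ?_
  rw [← Matrix.spectrum_toLin', ← Module.End.hasEigenvalue_iff_mem_spectrum] at hk
  obtain ⟨v, hv⟩ := hk.exists_hasEigenvector
  have hv1 : (A.map Complex.ofReal) *ᵥ v = k • v := by simpa using hv.apply_eq_smul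
  have hre : ∀ i, (A *ᵥ fun j => (v j).re) i = (k * v i).re := fun i => by
    have := congrArg Complex.re (congrFun hv1 i)
    simpa [Matrix.mulVec, dotProduct] using this
  have him : ∀ i, (A *ᵥ fun j => (v j).im) i = (k * v i).im := fun i => by
    have := congrArg Complex.im (congrFun hv1 i)
    simpa [Matrix.mulVec, dotProduct] using this
  have hsum := add_le_add (hreal fun j => (v j).re) (hreal fun j => (v j).im)
  simp only [hre, him] at hsum
  rw [← mul_add, ← Finset.sum_add_distrib, ← Finset.sum_add_distrib] at hsum
  have hn : ∀ z : ℂ, z.re ^ 2 + z.im ^ 2 = ‖z‖ ^ 2 := fun z => by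
    rw [Complex.sq_norm, Complex.normSq_apply]; ring
  simp only [hn, norm_mul, mul_pow] at hsum
  rw [← Finset.mul_sum] at hsum
  have hpos : 0 < ∑ i, ‖v i‖ ^ 2 := by
    obtain ⟨i, hi⟩ := Function.ne_iff.1 hv.2
    exact Finset.sum_pos' (fun _ _ => by positivity)
      ⟨i, Finset.mem_univ i, pow_pos (norm_pos_iff.2 hi) 2⟩
  have hk2 : ‖k‖ ≤ r := (pow_le_pow_iff_left₀ (norm_nonneg k) hr two_ne_zero).1
    (le_of_mul_le_mul_right hsum hpos)
  rw [← ENNReal.ofReal_coe_nnreal]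
  exact ENNReal.ofReal_le_ofReal hk2

/-! ### Tail of the log-likelihood ratio -/

theorem energy_add_smul {d n : ℕ} (r u : Fin (n + 1) → Fin d → ℝ) (c : ℝ) :
    energy (r + c • u) = energy r + c * (2 * ∑ t, ∑ i, r t i * u t i) + c ^ 2 * energy u := by
  simp only [energy, Finset.mul_sum, ← Finset.sum_add_distrib]
  refine Finset.sum_congr rfl fun t _ => Finset.sum_congr rfl fun i _ => ?_
  simp only [Pi.add_apply, Pi.smul_apply, smul_eq_mul]
  ring

theorem resid_sub_smul {d n : ℕ} (A D : Matrix (Fin d) (Fin d) ℝ) (c : ℝ)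
    (x : Fin (n + 1) → Fin d → ℝ) : resid n (A - c • D) x = resid n A x + c • shift n D x := by
  simp only [resid_apply]
  ext t i
  refine Fin.cases ?_ (fun s => ?_) t
  · simp [shift_apply_zero]
  · simp [shift_apply_succ, Matrix.sub_mulVec, Matrix.smul_mulVec]
    ring

/-- Under `A`, the log-likelihood ratio of `A` to `A₀` exceeds `a` with probability at most `1 / 4`.
Put `D = A - A₀`, let `u = shift n D x`, and let `r = resid n A x` be the innovations. Then
`energy (resid n A₀ x) - energy r = 2⟨r, u⟩ + energy u`. If this exceeds `2σ²a`, then either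
`energy u` is large, which Markov's inequality excludes, or `⟨r, u⟩` is. In the second case the
likelihood ratio of `A + 6D` to `A` is at least `exp (3a)`, and Markov's inequality for this
likelihood ratio, whose mean is `1`, replaces a martingale bound for `⟨r, u⟩`. -/
theorem sampleLaw_logLikelihood_tail {d n : ℕ} (A A₀ : Matrix (Fin d) (Fin d) ℝ) {σ r a : ℝ}
    (hσ : 0 < σ) (ha : Real.log 2 ≤ a)
    (hA : ∀ B : Matrix (Fin d) (Fin d) ℝ, frobSq (B * A) ≤ r ^ 2 * frobSq B)
    (hD : 56 * (frobSq (A - A₀) * (n * ∑ s ∈ Finset.range n, r ^ (2 * s))) ≤ a) :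
    sampleLaw A n σ {x | 2 * σ ^ 2 * a < energy (resid n A₀ x) - energy (resid n A x)} ≤
      ENNReal.ofReal (1 / 4) := by
  set D := A - A₀ with hDdef
  have ha0 : 0 < a := (Real.log_pos one_lt_two).trans_le ha
  have hσ2 : 0 < σ ^ 2 := by positivity
  have hE : Measurable fun x : Fin (n + 1) → Fin d → ℝ => energy (shift n D x) := by
    have := LinearMap.continuous_of_finiteDimensional (shift n D)
    unfold energy
    fun_prop
  have h₀ : ∀ x : Fin (n + 1) → Fin d → ℝ, resid n A₀ x = resid n A x + (1 : ℝ) • shift n D x :=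
    fun x => by
      rw [← resid_sub_smul, one_smul, hDdef, sub_sub_cancel]
  -- The factor `6` is chosen so that `exp (-6a/2) ≤ 1/8` for `a ≥ log 2`, and `7 = 6 + 1` so that
  -- the two thresholds add up.
  set T₁ : Set (Fin (n + 1) → Fin d → ℝ) :=
    {x | ENNReal.ofReal (σ ^ 2 * a / 7) ≤ ENNReal.ofReal (energy (shift n D x))}
  set T₂ : Set (Fin (n + 1) → Fin d → ℝ) :=
    {x | energy (resid n (A - (-6 : ℝ) • D) x) - energy (resid n A x) ≤ 2 * σ ^ 2 * (-(3 * a))}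
  have hsub : {x | 2 * σ ^ 2 * a < energy (resid n A₀ x) - energy (resid n A x)} ⊆ T₁ ∪ T₂ := by
    intro x hx
    by_cases h1 : σ ^ 2 * a / 7 ≤ energy (shift n D x)
    · exact Or.inl (ENNReal.ofReal_le_ofReal h1)
    · refine Or.inr ?_
      simp only [Set.mem_ofPred_eq, h₀, resid_sub_smul, energy_add_smul, T₂] at hx ⊢
      linarith
  have hT₁ : sampleLaw A n σ T₁ ≤ ENNReal.ofReal (1 / 8) := by
    have hmk := (mul_meas_ge_le_lintegral (μ := sampleLaw A n σ) hE.ennreal_ofReal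
      (ENNReal.ofReal (σ ^ 2 * a / 7))).trans (lintegral_energy_shift_le σ A D hA)
    have hc0 : ENNReal.ofReal (σ ^ 2 * a / 7) ≠ 0 := (ENNReal.ofReal_pos.2 (by positivity)).ne'
    rw [← ENNReal.mul_le_mul_iff_right hc0 ENNReal.ofReal_ne_top]
    refine hmk.trans ?_
    rw [← ENNReal.ofReal_mul (by positivity)]
    refine ENNReal.ofReal_le_ofReal ?_
    have := mul_le_mul_of_nonneg_left hD hσ2.le
    linarith
  have hT₂ : sampleLaw A n σ T₂ ≤ ENNReal.ofReal (1 / 8) := by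
    have hm : MeasurableSet T₂ := measurableSet_le
      ((measurable_energy_resid _).sub (measurable_energy_resid _)) measurable_const
    refine (sampleLaw_le_exp_mul A (A - (-6 : ℝ) • D) hσ (-(3 * a)) hm fun x hx => hx).trans ?_
    refine (mul_le_of_le_one_right' prob_le_one).trans (ENNReal.ofReal_le_ofReal ?_)
    calc Real.exp (-(3 * a)) ≤ Real.exp (-(3 * Real.log 2)) := Real.exp_le_exp.2 (by linarith)
      _ = 1 / 8 := by
        rw [Real.exp_neg, mul_comm, Real.exp_mul, Real.exp_log two_pos]
        norm_num
  refine (measure_mono hsub).trans ((measure_union_le _ _).trans ((add_le_add hT₁ hT₂).trans ?_))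
  rw [← ENNReal.ofReal_add (by norm_num) (by norm_num)]
  norm_num

/-- An event of probability at least `3 / 4` under `A` has probability at least `exp (-a) / 2`
under `A₀`. -/
theorem half_le_exp_mul_sampleLaw {d n : ℕ} (A A₀ : Matrix (Fin d) (Fin d) ℝ) {σ r a : ℝ}
    (hσ : 0 < σ) (ha : Real.log 2 ≤ a)
    (hA : ∀ B : Matrix (Fin d) (Fin d) ℝ, frobSq (B * A) ≤ r ^ 2 * frobSq B)
    (hD : 56 * (frobSq (A - A₀) * (n * ∑ s ∈ Finset.range n, r ^ (2 * s))) ≤ a)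
    {B : Set (Fin (n + 1) → Fin d → ℝ)} (hB : MeasurableSet B)
    (hAB : sampleLaw A n σ Bᶜ ≤ ENNReal.ofReal (1 / 4)) :
    1 / 2 ≤ Real.exp a * (sampleLaw A₀ n σ).real B := by
  set G : Set (Fin (n + 1) → Fin d → ℝ) :=
    {x | 2 * σ ^ 2 * a < energy (resid n A₀ x) - energy (resid n A x)} with hG
  have hGm : MeasurableSet G := measurableSet_lt measurable_const
    ((measurable_energy_resid _).sub (measurable_energy_resid _))
  have h1 := sampleLaw_le_exp_mul A A₀ hσ a (hB.diff hGm) fun x hx => not_lt.1 hx.2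
  have h2 : (sampleLaw A n σ).real (B \ G) ≤ Real.exp a * (sampleLaw A₀ n σ).real (B \ G) := by
    have := ENNReal.toReal_mono (ENNReal.mul_ne_top ENNReal.ofReal_ne_top (measure_ne_top _ _)) h1
    rwa [ENNReal.toReal_mul, ENNReal.toReal_ofReal (Real.exp_pos a).le] at this
  have h3 : (sampleLaw A₀ n σ).real (B \ G) ≤ (sampleLaw A₀ n σ).real B :=
    measureReal_mono Set.sdiff_subset
  have h4 : (sampleLaw A n σ).real G ≤ 1 / 4 :=
    ENNReal.toReal_le_of_le_ofReal (by norm_num) (sampleLaw_logLikelihood_tail A A₀ hσ ha hA hD)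
  have h5 : (sampleLaw A n σ).real Bᶜ ≤ 1 / 4 :=
    ENNReal.toReal_le_of_le_ofReal (by norm_num) hAB
  have h6 : (sampleLaw A n σ).real B ≤
      (sampleLaw A n σ).real (B \ G) + (sampleLaw A n σ).real G :=
    (measureReal_mono (by intro x hx; by_cases h : x ∈ G; exacts [Or.inr h, Or.inl ⟨hx, h⟩])).trans
      (measureReal_union_le _ _)
  have h7 := probReal_compl_eq_one_sub (μ := sampleLaw A n σ) hB
  have h8 := mul_le_mul_of_nonneg_left h3 (Real.exp_pos a).le
  linarith

/-! ### The family of parameters -/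

/-- The threshold `a = log ((2^m - 1) / (2δ))` is at least `log 2`, and at least a
quarter of `m + log (1/δ)`. -/
theorem le_log_div {m : ℕ} (hm : 1 ≤ m) {δ : ℝ} (hδ : 0 < δ) (hδ' : δ < 1 / 4) :
    Real.log 2 ≤ Real.log (((2 : ℝ) ^ m - 1) / (2 * δ)) ∧
      (m + Real.log (1 / δ)) / 4 ≤ Real.log (((2 : ℝ) ^ m - 1) / (2 * δ)) := by
  obtain ⟨k, rfl⟩ : ∃ k, m = k + 1 := ⟨m - 1, by omega⟩
  have hlog2 := Real.log_two_gt_d9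
  have hpow : (2 : ℝ) ^ k ≤ 2 ^ (k + 1) - 1 := by
    have : (1 : ℝ) ≤ 2 ^ k := one_le_pow₀ one_le_two
    rw [pow_succ]; linarith
  have h1 : k * Real.log 2 + Real.log (1 / δ) - Real.log 2 ≤
      Real.log (((2 : ℝ) ^ (k + 1) - 1) / (2 * δ)) := by
    have : k * Real.log 2 + Real.log (1 / δ) - Real.log 2 = Real.log (2 ^ k / (2 * δ)) := by
      rw [Real.log_div (pow_ne_zero k two_ne_zero) (by positivity),
        Real.log_mul two_ne_zero hδ.ne', Real.log_pow, one_div, Real.log_inv]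
      ring
    rw [this]
    exact Real.log_le_log (by positivity) (by gcongr)
  have h2 : 2 * Real.log 2 ≤ Real.log (1 / δ) := by
    have : 2 * Real.log 2 = Real.log 4 := by
      rw [show (4 : ℝ) = 2 ^ 2 by norm_num, Real.log_pow]; norm_num
    rw [this]
    refine Real.log_le_log (by norm_num) ?_
    rw [le_div_iff₀ hδ]; linarith
  have hk : (0 : ℝ) ≤ k := Nat.cast_nonneg k
  have h3 : 0 ≤ k * (Real.log 2 - 1 / 4) := mul_nonneg hk (by linarith)
  have h4 : 0 ≤ k * Real.log 2 := mul_nonneg hk (by linarith)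
  push_cast
  constructor <;> linarith

theorem frobSq_transition_sub {d m : ℕ} (R : Matrix (Fin d × Fin d) (Fin m) ℝ)
    (γ : EuclideanSpace ℝ (Fin d × Fin d)) (θ θ' : Fin m → ℝ) :
    frobSq (transition R γ θ - transition R γ θ') = ‖coeff R γ θ - coeff R γ θ'‖ ^ 2 := by
  rw [EuclideanSpace.norm_sq_eq, Fintype.sum_prod_type]
  simp [frobSq, transition]

/-- The linear part `θ ↦ R θ` of the coefficient map. -/
def linearCoeff {d m : ℕ} (R : Matrix (Fin d × Fin d) (Fin m) ℝ) :
    (Fin m → ℝ) →ₗ[ℝ] EuclideanSpace ℝ (Fin d × Fin d) :=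
  (WithLp.linearEquiv 2 ℝ (Fin d × Fin d → ℝ)).symm.toLinearMap ∘ₗ R.mulVecLin

theorem coeff_add {d m : ℕ} (R : Matrix (Fin d × Fin d) (Fin m) ℝ)
    (γ : EuclideanSpace ℝ (Fin d × Fin d)) (θ τ : Fin m → ℝ) :
    coeff R γ (θ + τ) = coeff R γ θ + linearCoeff R τ := by
  simp [coeff, linearCoeff, Matrix.mulVec_add, add_right_comm]

theorem finrank_range_linearCoeff {d m : ℕ} (R : Matrix (Fin d × Fin d) (Fin m) ℝ) :
    Module.finrank ℝ (LinearMap.range (linearCoeff R)) = R.rank := by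
  rw [linearCoeff, LinearMap.range_comp, LinearEquiv.finrank_map_eq]
  rfl

/-- There are `2^m - 1` parameters which together with `θ₀` have `2ε`-separated coefficient vectors,
all within distance `4ε` of the one at `θ₀`. -/
theorem exists_separated_parameters {d m : ℕ} {R : Matrix (Fin d × Fin d) (Fin m) ℝ}
    (hR : R.rank = m) (γ : EuclideanSpace ℝ (Fin d × Fin d)) (θ₀ : Fin m → ℝ) {ε : ℝ}
    (hε : 0 < ε) :
    ∃ S : Finset (Fin m → ℝ), (S.card : ℝ) = 2 ^ m - 1 ∧
      (∀ θ ∈ S, ‖coeff R γ θ - coeff R γ θ₀‖ ≤ 4 * ε ∧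
        2 * ε ≤ ‖coeff R γ θ - coeff R γ θ₀‖) ∧
      ∀ θ ∈ S, ∀ θ' ∈ S, θ ≠ θ' → 2 * ε ≤ ‖coeff R γ θ - coeff R γ θ'‖ := by
  classical
  obtain ⟨S, hcard, h0, hS, hsep⟩ := exists_finset_separated
    ((finrank_range_linearCoeff R).trans hR) hε (2 ^ m - 1) (by have := Nat.two_pow_pos m; omega)
  choose τ hτ using fun v : LinearMap.range (linearCoeff R) => v.2
  have hτ' : ∀ v w, linearCoeff R (τ v) - linearCoeff R (τ w) = ((v - w :
      LinearMap.range (linearCoeff R)) : EuclideanSpace ℝ (Fin d × Fin d)) := fun v w => by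
    rw [hτ, hτ]; rfl
  have hinj : Function.Injective fun v => θ₀ + τ v := fun v w h => by
    have h' := hτ' v w
    rw [add_left_cancel h, sub_self] at h'
    exact sub_eq_zero.1 (Subtype.ext h'.symm)
  refine ⟨(S.erase 0).image fun v => θ₀ + τ v, ?_, ?_, ?_⟩
  · rw [Finset.card_image_of_injective _ hinj, Finset.card_erase_of_mem h0, hcard,
      Nat.add_sub_cancel, Nat.cast_sub Nat.one_le_two_pow]
    simp
  · intro θ hθ
    obtain ⟨v, hv, rfl⟩ := Finset.mem_image.1 hθ
    rw [coeff_add, add_sub_cancel_left, hτ]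
    have := hsep v (Finset.mem_of_mem_erase hv) 0 h0 (Finset.ne_of_mem_erase hv)
    rw [sub_zero] at this
    exact ⟨hS v (Finset.mem_of_mem_erase hv), this⟩
  · intro θ hθ θ' hθ' hne
    obtain ⟨v, hv, rfl⟩ := Finset.mem_image.1 hθ
    obtain ⟨w, hw, rfl⟩ := Finset.mem_image.1 hθ'
    rw [coeff_add, coeff_add, add_sub_add_left_eq_sub, hτ']
    exact hsep v (Finset.mem_of_mem_erase hv) w (Finset.mem_of_mem_erase hw)
      fun h => hne (by rw [h])

/-- The operator norm is at most the Frobenius norm, so that coefficient vectors within `4ε` of the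
one at `θ₀` belong to transition matrices of operator norm at most `ρ`. -/
theorem norm_transition_le {d m : ℕ} {R : Matrix (Fin d × Fin d) (Fin m) ℝ}
    {γ : EuclideanSpace ℝ (Fin d × Fin d)} {θ θ₀ : Fin m → ℝ} {ε ρ : ℝ}
    (hθ₀ : ‖Matrix.toEuclideanCLM (𝕜 := ℝ) (transition R γ θ₀)‖ + 4 * ε ≤ ρ)
    (hθ : ‖coeff R γ θ - coeff R γ θ₀‖ ≤ 4 * ε) :
    ‖Matrix.toEuclideanCLM (𝕜 := ℝ) (transition R γ θ)‖ ≤ ρ := by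
  have h := norm_toEuclideanCLM_le (transition R γ θ - transition R γ θ₀)
  rw [frobSq_transition_sub, Real.sqrt_sq (norm_nonneg _), map_sub] at h
  have := norm_le_norm_add_norm_sub' (Matrix.toEuclideanCLM (𝕜 := ℝ) (transition R γ θ))
    (Matrix.toEuclideanCLM (𝕜 := ℝ) (transition R γ θ₀))
  linarith

/-! ### The lower bound -/

/-- If an estimator errs by `ε` or more with probability less than `δ` at each of the `2^m` parameters,
then the `2^m - 1` disjoint events of being within `ε` of a coefficient vector other than that at
`θ₀` have total probability less than `δ` at `θ₀`. By the change of measure each of them has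
probability at least `exp (-a) / 2` there, and `a` is chosen so that these lower bounds sum to
exactly `δ`. -/
theorem minimax_lower_bound {d m n : ℕ} {R : Matrix (Fin d × Fin d) (Fin m) ℝ}
    {γ : EuclideanSpace ℝ (Fin d × Fin d)} {σ δ ρ ε : ℝ} (hm : 1 ≤ m) (hR : R.rank = m)
    (hσ : 0 < σ) (hδ : 0 < δ) (hδ' : δ < 1 / 4) (hε : 0 < ε) {θ₀ : Fin m → ℝ}
    (hθ₀ : ‖Matrix.toEuclideanCLM (𝕜 := ℝ) (transition R γ θ₀)‖ + 4 * ε ≤ ρ)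
    (hn : (n : ℝ) * ∑ s ∈ Finset.range n, ρ ^ (2 * s) ≤
      1 / 3584 * ((m + Real.log (1 / δ)) / ε ^ 2)) (b : Estimator d n) :
    ENNReal.ofReal δ ≤ ⨆ θ ∈ paramSet R γ ρ,
      sampleLaw (transition R γ θ) n σ {x | ε ≤ ‖b.1 x - coeff R γ θ‖} := by
  by_contra! hlt
  have hrisk : ∀ θ, ‖coeff R γ θ - coeff R γ θ₀‖ ≤ 4 * ε →
      sampleLaw (transition R γ θ) n σ {x | ε ≤ ‖b.1 x - coeff R γ θ‖} < ENNReal.ofReal δ :=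
    fun θ hθ => (le_iSup₂_of_le θ
      (spectralRadius_map_ofReal_le _ (norm_transition_le hθ₀ hθ)) le_rfl).trans_lt hlt
  obtain ⟨ha2, ha⟩ := le_log_div hm hδ hδ'
  set a := Real.log (((2 : ℝ) ^ m - 1) / (2 * δ)) with hadef
  have hM : (1 : ℝ) ≤ 2 ^ m - 1 := by
    have : (2 : ℝ) ^ 1 ≤ 2 ^ m := pow_le_pow_right₀ one_le_two hm
    linarith
  have hexp : Real.exp a = (2 ^ m - 1) / (2 * δ) := Real.exp_log (by positivity)
  obtain ⟨S, hcard, hS, hsep⟩ := exists_separated_parameters hR γ θ₀ hε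
  set P₀ := sampleLaw (transition R γ θ₀) n σ with hP₀
  let B : (Fin m → ℝ) → Set (Fin (n + 1) → Fin d → ℝ) := fun θ => {x | ‖b.1 x - coeff R γ θ‖ < ε}
  have hBm : ∀ θ, MeasurableSet (B θ) := fun θ =>
    measurableSet_lt (b.2.sub_const _).norm measurable_const
  have hfar : ∀ {θ θ' x}, 2 * ε ≤ ‖coeff R γ θ - coeff R γ θ'‖ → x ∈ B θ → x ∉ B θ' := by
    intro θ θ' x h h1 h2
    have h3 := norm_sub_le_norm_sub_add_norm_sub (coeff R γ θ) (b.1 x) (coeff R γ θ')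
    rw [norm_sub_rev (coeff R γ θ) (b.1 x)] at h3
    have h1' : ‖b.1 x - coeff R γ θ‖ < ε := h1
    have h2' : ‖b.1 x - coeff R γ θ'‖ < ε := h2
    linarith
  -- The constant: `3584 = 56 * 4 ^ 2 * 4`.
  have hhalf : ∀ θ ∈ S, 1 / 2 ≤ Real.exp a * P₀.real (B θ) := by
    intro θ hθ
    refine half_le_exp_mul_sampleLaw (transition R γ θ) (transition R γ θ₀) (r := ρ) hσ ha2
      (fun B => (frobSq_mul_le _ B).trans ?_) ?_ (hBm θ) ?_
    · have := norm_transition_le hθ₀ (hS θ hθ).1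
      have := frobSq_nonneg B
      gcongr
    · rw [frobSq_transition_sub]
      have h1 : ‖coeff R γ θ - coeff R γ θ₀‖ ^ 2 ≤ (4 * ε) ^ 2 :=
        pow_le_pow_left₀ (norm_nonneg _) (hS θ hθ).1 2
      have h2 : 0 ≤ (n : ℝ) * ∑ s ∈ Finset.range n, ρ ^ (2 * s) :=
        mul_nonneg (Nat.cast_nonneg n)
          (Finset.sum_nonneg fun s _ => (even_two_mul s).pow_nonneg ρ)
      calc _ ≤ 56 * ((4 * ε) ^ 2 * (1 / 3584 * ((m + Real.log (1 / δ)) / ε ^ 2))) := by gcongr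
        _ = (m + Real.log (1 / δ)) / 4 := by field_simp; norm_num
        _ ≤ a := ha
    · have : (B θ)ᶜ = {x | ε ≤ ‖b.1 x - coeff R γ θ‖} := by ext x; simp [B]
      rw [this]
      exact (hrisk θ (hS θ hθ).1).le.trans (ENNReal.ofReal_le_ofReal hδ'.le)
  have hsum : ∑ θ ∈ S, P₀.real (B θ) < δ := by
    rw [← measureReal_biUnion_finset (fun θ hθ θ' hθ' hne =>
      Set.disjoint_left.2 fun x hx => hfar (hsep θ hθ θ' hθ' hne) hx) fun θ _ => hBm θ]
    refine (measureReal_mono (s₂ := {x | ε ≤ ‖b.1 x - coeff R γ θ₀‖}) ?_).trans_lt ?_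
    · refine Set.iUnion₂_subset fun θ hθ x hx => ?_
      exact le_of_not_gt (a := ε) (hfar (hS θ hθ).2 hx)
    · exact (ENNReal.toReal_lt_of_lt_ofReal (hrisk θ₀ (by simpa using hε.le)))
  have hfinal := Finset.sum_le_sum hhalf
  rw [← Finset.mul_sum, Finset.sum_const, nsmul_eq_mul, hcard] at hfinal
  have := mul_lt_mul_of_pos_left hsum (Real.exp_pos a)
  rw [hexp, show (2 ^ m - 1) / (2 * δ) * δ = (2 ^ m - 1) * (1 / 2 : ℝ) by field_simp] at this
  rw [hexp] at hfinal
  linarith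

end RestrictedVAR

open RestrictedVAR in
theorem theorem4 :
    ∃ c : ℝ, 0 < c ∧
      ∀ (d m n : ℕ) (R : Matrix (Fin d × Fin d) (Fin m) ℝ)
        (γ : EuclideanSpace ℝ (Fin d × Fin d)) (σ δ ρ ε : ℝ),
        1 ≤ m → R.rank = m → 0 < σ → 0 < δ → δ < 1 / 4 → 0 < ρ → 0 < ε → ε ≤ ρ / 4 →
        (γ = 0 ∨ ∃ θ₀ : Fin m → ℝ,
          ‖Matrix.toEuclideanCLM (𝕜 := ℝ) (transition R γ θ₀)‖ + 4 * ε ≤ ρ) →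
        (n : ℝ) * ∑ s ∈ Finset.range n, ρ ^ (2 * s) ≤ c * ((m + Real.log (1 / δ)) / ε ^ 2) →
        ENNReal.ofReal δ ≤
          ⨅ b : Estimator d n, ⨆ θ ∈ paramSet R γ ρ,
            sampleLaw (transition R γ θ) n σ {x | ε ≤ ‖b.1 x - coeff R γ θ‖} := by
  refine ⟨1 / 3584, by norm_num, ?_⟩
  intro d m n R γ σ δ ρ ε hm hR hσ hδ hδ' _ hε hερ hγ hn
  refine le_iInf fun b => ?_
  obtain ⟨θ₀, hθ₀⟩ : ∃ θ₀ : Fin m → ℝ,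
      ‖Matrix.toEuclideanCLM (𝕜 := ℝ) (transition R γ θ₀)‖ + 4 * ε ≤ ρ := by
    rcases hγ with rfl | h
    · refine ⟨0, ?_⟩
      have : transition R 0 0 = 0 := by
        ext i j
        simp [transition, coeff]
      rw [this, map_zero, norm_zero]
      linarith
    · exact h
  exact minimax_lower_bound hm hR hσ hδ hδ' hε hθ₀ hn b
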